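/- Let $K$ be a field of characteristic zero, $R=K[x_1,\dots,x_n]$, and let $\succ$ be an admissible monomial ordering with $x_1\succ x_2\succ\cdots\succ x_n$; $\mathrm{lm}(f)$ denotes the leading monomial of $f\neq 0$, and $\mathrm{in}_\succ(I)$ the ideal generated by the leading monomials of the nonzero elements of $I$. *Divisions.* For a monomial $u$, the variable $x_i$ is Pommaret multiplicative if $i\ge j$ for every variable $x_j$ occurring in $u$. For an element $u$ of a finite set $U$ of monomials, $x_i$ is Janet multiplicative if $\deg_{x_i}(u)$ is the largest of the numbers $\deg_{x_i}(v)$, where $v\in U$ and $\deg_{x_j}(v)=\deg_{x_j}(u)$ for all $j<i$. A monomial $u$ is a Pommaret (Janet) divisor of $w$ if $u\mid w$ and $w/u$ contains only variables that are multiplicative for $u$. For a set $F$ of nonzero polynomials the divisions are applied to the leading monomials (for Janet, $F$ is finite and $U=\mathrm{lm}(F)$). *Bases.* A set $F$ of nonzero polynomials is a Pommaret basis of the ideal $I$ it generates if (a) no term of an $f\in F$ has a Pommaret divisor $\mathrm{lm}(g)$ with $g\in F$, $g\ne f$, and (b) for every $f\in F$ and every variable $x$ that is not Pommaret multiplicative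 for $\mathrm{lm}(f)$, the product $x f$ reduces to $0$ modulo $F$ by reductions at terms having a Pommaret divisor in $\mathrm{lm}(F)$. Janet bases are the finite sets defined in the same way with the Janet division. A Janet basis $G$ of $I$ is minimal if $\mathrm{lm}(G)\subseteq\mathrm{lm}(F)$ for every Janet basis $F$ of $I$. *Generic position.* An ideal $I\subseteq R$ is in generic position (with respect to $\succ$) if there is a nonempty Zariski open set $U\subseteq GL_n(K)$ such that $\mathrm{in}_\succ(A\cdot I)=\mathrm{in}_\succ(I)$ for all $A\in U$, where $A\cdot I$ is the image of $I$ under the linear change of variables given by $A$; that is, $\mathrm{in}_\succ(I)$ is the generic initial ideal of $I$. **Statement.** Let $I\subseteq R$ be an ideal in generic position. Then $I$ has exactly one monic minimal Janet basis, and a subset of $R$ is a minimal Janet basis of $I$ if and only if it is a Pommaret basis of $I$. If moreover $I$ is homogeneous, then the monic minimal Janet basis of $I$, the monic Pommaret basis of $I$ and the reduced Gröbner basis of $I$ (all with respect to $\succ$) coincide. -/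

import Mathlib

open MvPolynomial

/-- Exponent vectors of the monomials in `x_0, ..., x_{n-1}`. -/
abbrev Mon (n : ℕ) : Type := Fin n →₀ ℕ

/-- `x_i` is Pommaret multiplicative for `u`: the index `i` is at least the largest index of a
variable occurring in `u` (all variables are multiplicative for `u = 1`). -/
def PommaretMult {n : ℕ} (u : Mon n) (i : Fin n) : Prop :=
  ∀ j, u j ≠ 0 → j ≤ i

/-- `x_i` is Janet multiplicative for `u` as an element of `U`: `u` has the largest degree in
`x_i` among the elements of `U` having the same degrees as `u` in all `x_j` with `j < i`. -/
def JanetMult {n : ℕ} (U : Set (Mon n)) (u : Mon n) (i : Fin n) : Prop :=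
  ∀ v ∈ U, (∀ j, j < i → v j = u j) → v i ≤ u i

/-- Given a separation of variables `M` (`M u i` says that `x_i` is multiplicative for `u`),
`u` is an involutive divisor of `w`: `u` divides `w`, and `w / u` is a monomial in the
multiplicative variables of `u`. -/
def InvDvd {n : ℕ} (M : Mon n → Fin n → Prop) (u w : Mon n) : Prop :=
  u ≤ w ∧ ∀ i, u i < w i → M u i

section

variable {K : Type*} [Field K] {n : ℕ} (m : MonomialOrder (Fin n))

/-- The set of leading monomials of a set of polynomials. -/
def lmSet (F : Set (MvPolynomial (Fin n) K)) : Set (Mon n) :=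
  {u | ∃ f ∈ F, m.degree f = u}

/-- No term of an element of `F` is an involutive multiple of the leading monomial of a different
element of `F`. -/
def InvAutoreduced (M : Mon n → Fin n → Prop) (F : Set (MvPolynomial (Fin n) K)) : Prop :=
  ∀ f ∈ F, ∀ g ∈ F, g ≠ f → ∀ t ∈ f.support, ¬ InvDvd M (m.degree g) t

/-- One involutive reduction step modulo `F`: a term of `h` that has an involutive divisor
`lm(f)`, `f ∈ F`, is cancelled by subtracting a multiple of `f`. -/
def InvStep (M : Mon n → Fin n → Prop) (F : Set (MvPolynomial (Fin n) K))
    (h h' : MvPolynomial (Fin n) K) : Prop :=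
  ∃ f ∈ F, ∃ t ∈ h.support, InvDvd M (m.degree f) t ∧
    h' = h - monomial (t - m.degree f) (h.coeff t / m.leadingCoeff f) * f

/-- `h` is in involutive normal form modulo `F`: no term of `h` has an involutive divisor among
the leading monomials of `F`. -/
def InvNormal (M : Mon n → Fin n → Prop) (F : Set (MvPolynomial (Fin n) K))
    (h : MvPolynomial (Fin n) K) : Prop :=
  ∀ t ∈ h.support, ∀ f ∈ F, ¬ InvDvd M (m.degree f) t

/-- `r` is an involutive normal form of `h` modulo `F` (it is unique when `F` is involutively
autoreduced). -/
def IsInvNormalForm (M : Mon n → Fin n → Prop) (F : Set (MvPolynomial (Fin n) K))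
    (h r : MvPolynomial (Fin n) K) : Prop :=
  Relation.ReflTransGen (InvStep m M F) h r ∧ InvNormal m M F r

/-- `F` is an involutive basis of the ideal `I` for the separation of variables `M`: a set of
nonzero polynomials generating `I`, involutively autoreduced, such that every nonmultiplicative
prolongation `f * x_i` has involutive normal form `0`. -/
structure IsInvBasis (M : Mon n → Fin n → Prop) (I : Ideal (MvPolynomial (Fin n) K))
    (F : Set (MvPolynomial (Fin n) K)) : Prop where
  zero_notMem : (0 : MvPolynomial (Fin n) K) ∉ F
  span_eq : Ideal.span F = I
  autoreduced : InvAutoreduced m M F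
  prolongation : ∀ f ∈ F, ∀ i, ¬ M (m.degree f) i → IsInvNormalForm m M F (f * X i) 0

/-- `G` is a (possibly infinite) Pommaret basis of `I`. -/
def IsPommaretBasis (I : Ideal (MvPolynomial (Fin n) K))
    (G : Set (MvPolynomial (Fin n) K)) : Prop :=
  IsInvBasis m PommaretMult I G

/-- `G` is a Janet basis of `I`. -/
def IsJanetBasis (I : Ideal (MvPolynomial (Fin n) K))
    (G : Set (MvPolynomial (Fin n) K)) : Prop :=
  G.Finite ∧ IsInvBasis m (JanetMult (lmSet m G)) I G

/-- `G` is a minimal Janet basis of `I`: its leading monomials are among those of every Janet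
basis of `I`. -/
def IsMinimalJanetBasis (I : Ideal (MvPolynomial (Fin n) K))
    (G : Set (MvPolynomial (Fin n) K)) : Prop :=
  IsJanetBasis m I G ∧ ∀ F, IsJanetBasis m I F → lmSet m G ⊆ lmSet m F

/-- All elements of `G` have leading coefficient `1`. -/
def IsMonicSet (G : Set (MvPolynomial (Fin n) K)) : Prop :=
  ∀ g ∈ G, m.leadingCoeff g = 1

/-- The initial ideal of `I`, generated by the leading monomials of the nonzero elements. -/
noncomputable def initialIdeal (I : Ideal (MvPolynomial (Fin n) K)) : Ideal (MvPolynomial (Fin n) K) :=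
  Ideal.span {p | ∃ f ∈ I, f ≠ 0 ∧ p = monomial (m.degree f) 1}

/-- `G` is a reduced Gröbner basis of `I`: a finite subset of `I` consisting of monic polynomials,
whose leading monomials generate the initial ideal, and such that no term of an element of `G`
is divisible by the leading monomial of a different element. -/
structure IsReducedGroebnerBasis (I : Ideal (MvPolynomial (Fin n) K))
    (G : Set (MvPolynomial (Fin n) K)) : Prop where
  finite : G.Finite
  subset : G ⊆ I
  initial : Ideal.span {p | ∃ g ∈ G, p = monomial (m.degree g) 1} = initialIdeal m I
  monic : IsMonicSet m G
  reduced : ∀ f ∈ G, ∀ g ∈ G, g ≠ f → ∀ t ∈ f.support, ¬ m.degree g ≤ t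

/-- The linear change of variables `x_j ↦ ∑ i, A i j * x_i`. -/
noncomputable def linChange (A : GL (Fin n) K) :
    MvPolynomial (Fin n) K →ₐ[K] MvPolynomial (Fin n) K :=
  aeval fun j => ∑ i, C ((A : Matrix (Fin n) (Fin n) K) i j) * X i

/-- Zariski open subsets of the general linear group: the complements of the common zero sets
of families of polynomials in the matrix entries. -/
def IsZariskiOpen (U : Set (GL (Fin n) K)) : Prop :=
  ∃ S : Set (MvPolynomial (Fin n × Fin n) K),
    U = {A : GL (Fin n) K | ∃ p ∈ S, eval (fun ij => (A : Matrix (Fin n) (Fin n) K) ij.1 ij.2) p ≠ 0}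

/-- `I` is in generic position with respect to `m`: its initial ideal is the generic one, that
is, the one of the image of `I` under every linear change of variables in some nonempty Zariski
open subset of the general linear group. -/
def IsInGenericPosition (I : Ideal (MvPolynomial (Fin n) K)) : Prop :=
  ∃ U : Set (GL (Fin n) K), IsZariskiOpen U ∧ U.Nonempty ∧
    ∀ A ∈ U, initialIdeal m (I.map (linChange A)) = initialIdeal m I

attribute [local instance] MvPolynomial.gradedAlgebra in
/-- `I` is a homogeneous ideal for the standard grading by total degree. -/
def IsHomogeneousIdeal (I : Ideal (MvPolynomial (Fin n) K)) : Prop :=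
  I.IsHomogeneous (homogeneousSubmodule (Fin n) K)

end

/-! Everything is read off from the set N of leading exponents of I. In characteristic zero, generic
position makes N strongly stable: a variable in an element of N may be replaced by a larger one
(`IsInGenericPosition.exchange`). To see this, move I by some A in the open set and apply the family
`x_j ↦ x_j + t x_i` over `K[t]`. The extended ideal is closed under the derivation `∂/∂t - x_i
∂/∂x_j`, which turns a leading monomial `v x_j` into `v x_i`. For a suitable value of t the
specialization keeps the leading exponents and stays in the open set, so the exponents of the family
are exactly N. The multiplicative multiples of a Pommaret or Janet basis span the ideal and have
distinct leading monomials; hence every element of N has an involutive divisor among the leading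
monomials of the basis (`IsInvBasis.exists_invDvd`). Conversely, this covering property makes an
autoreduced subset of I a basis. For strongly stable N the minimal generators already cover N in the
Pommaret sense (`exists_minGens_invDvd`), and on them the two divisions agree
(`janetMult_minGens_eq`). Pommaret bases and minimal Janet bases are therefore both the sets in
`IsTailReducedBasis`. Their monic representative exists, is unique, and is the reduced Gröbner
basis. -/

/-! ### Leading exponents and minimal generators -/

section LeadingExponents

variable {n : ℕ} (m : MonomialOrder (Fin n))

/-- The exponents of the leading monomials of the nonzero elements of an ideal. -/
def leadExps {A : Type*} [CommRing A] (I : Ideal (MvPolynomial (Fin n) A)) : Set (Mon n) :=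
  {u | ∃ f ∈ I, f ≠ 0 ∧ m.degree f = u}

/-- The minimal elements of a set of exponents with respect to divisibility. -/
def minGens (N : Set (Mon n)) : Set (Mon n) :=
  {u | Minimal (· ∈ N) u}

/-- Dickson's lemma. -/
theorem minGens_finite (N : Set (Mon n)) : (minGens N).Finite :=
  WellQuasiOrderedLE.finite_of_isAntichain (setOfPred_minimal_antichain _)

theorem exists_minGens_le {N : Set (Mon n)} {w : Mon n} (hw : w ∈ N) :
    ∃ u ∈ minGens N, u ≤ w := by
  obtain ⟨u, hu, hmin⟩ := exists_minimal_le_of_wellFoundedLT (· ∈ N) w hw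
  exact ⟨u, hmin, hu⟩

theorem minGens_subset (N : Set (Mon n)) : minGens N ⊆ N := fun _ hu => hu.prop

theorem isUpperSet_leadExps {A : Type*} [CommRing A] [IsDomain A]
    (I : Ideal (MvPolynomial (Fin n) A)) : IsUpperSet (leadExps m I) := by
  classical
  rintro u w huw ⟨f, hf, hf0, rfl⟩
  have h1 : (monomial (w - m.degree f) (1 : A)) ≠ 0 := by simp
  refine ⟨monomial (w - m.degree f) 1 * f, I.mul_mem_left _ hf, mul_ne_zero h1 hf0, ?_⟩
  rw [m.degree_mul h1 hf0, m.degree_monomial, if_neg one_ne_zero, tsub_add_cancel_of_le huw]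

theorem initialIdeal_eq_span {K : Type*} [Field K] (I : Ideal (MvPolynomial (Fin n) K)) :
    initialIdeal m I = Ideal.span ((fun u => monomial u (1 : K)) '' leadExps m I) := by
  unfold initialIdeal
  congr 1
  ext p
  constructor
  · rintro ⟨f, hf, h0, rfl⟩
    exact ⟨_, ⟨f, hf, h0, rfl⟩, rfl⟩
  · rintro ⟨_, ⟨f, hf, h0, rfl⟩, rfl⟩
    exact ⟨f, hf, h0, rfl⟩

theorem monomial_mem_span_iff {K : Type*} [Field K] (S : Set (Mon n)) (u : Mon n) :
    monomial u (1 : K) ∈ Ideal.span ((fun u => monomial u (1 : K)) '' S) ↔ ∃ v ∈ S, v ≤ u := by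
  classical
  rw [mem_ideal_span_monomial_image]
  simp [support_monomial]

theorem mem_leadExps_iff {K : Type*} [Field K] (I : Ideal (MvPolynomial (Fin n) K)) (u : Mon n) :
    u ∈ leadExps m I ↔ monomial u (1 : K) ∈ initialIdeal m I := by
  rw [initialIdeal_eq_span, monomial_mem_span_iff]
  exact ⟨fun h => ⟨u, h, le_rfl⟩, fun ⟨v, hv, h⟩ => isUpperSet_leadExps m I h hv⟩

variable {m} in
/-- If a coefficient of `f` at `u` is nonzero and all terms of `f` are at most `u`, then `u` is
the degree of `f`. -/
theorem degree_eq_of_forall_le {A : Type*} [CommRing A] {f : MvPolynomial (Fin n) A} {u : Mon n}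
    (hu : f.coeff u ≠ 0) (h : ∀ v ∈ f.support, m.toSyn v ≤ m.toSyn u) : m.degree f = u :=
  m.toSyn.injective <| le_antisymm (m.degree_le_iff.2 h) (m.le_degree (mem_support_iff.2 hu))

end LeadingExponents

/-! ### Leading exponents under specialization of coefficients -/

section Specialization

variable {n : ℕ} (m : MonomialOrder (Fin n)) {A K : Type*} [CommRing A] [IsDomain A] [Field K]

omit [IsDomain A] in
variable {m} in
theorem degree_map_of_ne_zero {f : MvPolynomial (Fin n) A} {φ : A →+* K}
    (h : φ (m.leadingCoeff f) ≠ 0) :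
    MvPolynomial.map φ f ≠ 0 ∧ m.degree (MvPolynomial.map φ f) = m.degree f := by
  have h1 : (MvPolynomial.map φ f).coeff (m.degree f) ≠ 0 := by rwa [coeff_map]
  refine ⟨fun h0 => by simp [h0] at h1, degree_eq_of_forall_le h1 fun v hv => ?_⟩
  exact m.le_degree (support_map_subset _ _ hv)

omit [IsDomain A] in
-- If `φ` kills the leading coefficient of `f`, a pseudo-reduction lowers the degree of `f` and
-- changes its image only by a nonzero scalar, so induction on the degree applies.
theorem degree_map_mem_of_forall_minGens (J : Ideal (MvPolynomial (Fin n) A)) {φ : A →+* K}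
    (hφ : ∀ u ∈ minGens (leadExps m J), ∃ g ∈ J, m.degree g = u ∧ φ (m.leadingCoeff g) ≠ 0)
    (f : MvPolynomial (Fin n) A) (hf : f ∈ J) (h0 : MvPolynomial.map φ f ≠ 0) :
    m.degree (MvPolynomial.map φ f) ∈ leadExps m J := by
  classical
  induction hd : m.toSyn (m.degree f) using WellFoundedLT.induction generalizing f with
  | ind d ih =>
  subst hd
  have hf0 : f ≠ 0 := by rintro rfl; simp at h0
  have hfJ : m.degree f ∈ leadExps m J := ⟨f, hf, hf0, rfl⟩
  by_cases hc : φ (m.leadingCoeff f) = 0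
  swap
  · rwa [(degree_map_of_ne_zero hc).2]
  obtain ⟨u, hu, hle⟩ := exists_minGens_le hfJ
  obtain ⟨g, hg, rfl, hgc⟩ := hφ u hu
  -- Cross-multiplying avoids division in `A`. The subtracted multiple of `g` carries the factor
  -- `m.leadingCoeff f`, which `φ` kills.
  set r := C (m.leadingCoeff g) * f -
    monomial (m.degree f - m.degree g) (m.leadingCoeff f) * g with hr
  have hrJ : r ∈ J := J.sub_mem (J.mul_mem_left _ hf) (J.mul_mem_left _ hg)
  have hmap : MvPolynomial.map φ r = C (φ (m.leadingCoeff g)) * MvPolynomial.map φ f := by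
    simp [hr, map_monomial, hc]
  have hr0 : MvPolynomial.map φ r ≠ 0 := by
    rw [hmap]; exact mul_ne_zero (by simpa using hgc) h0
  have hdeg : m.degree (MvPolynomial.map φ r) = m.degree (MvPolynomial.map φ f) := by
    rw [hmap, m.degree_mul (by simpa using hgc) h0, m.degree_C, zero_add]
  rw [← hdeg]
  refine ih _ ?_ r hrJ hr0 rfl
  have hg0 : g ≠ 0 := by rintro rfl; simp at hgc
  have hrne : r ≠ 0 := by rintro h; simp [h] at hr0
  have hle2 : m.toSyn (m.degree r) ≤ m.toSyn (m.degree f) := by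
    refine m.degree_sub_le.trans (max_le ?_ ?_)
    · refine m.degree_mul_le.trans ?_
      simp
    · refine m.degree_mul_le.trans ?_
      rw [map_add]
      refine (add_le_add_left (m.degree_monomial_le _) _).trans ?_
      rw [← map_add, tsub_add_cancel_of_le hle]
  refine lt_of_le_of_ne hle2 fun heq => ?_
  have heq := m.toSyn.injective heq
  have h1 : r.coeff (m.degree f) ≠ 0 := by
    rw [← heq]; exact m.coeff_degree_ne_zero_iff.2 hrne
  apply h1
  rw [hr, coeff_sub, coeff_C_mul, coeff_monomial_mul', if_pos tsub_le_self,
    tsub_tsub_cancel_of_le hle]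
  simp only [MonomialOrder.leadingCoeff]
  ring

/-- The initial ideal is preserved by generic specializations of the coefficients. -/
theorem exists_leadExps_map_eq (J : Ideal (MvPolynomial (Fin n) A)) :
    ∃ s : A, s ≠ 0 ∧ ∀ φ : A →+* K, Function.Surjective φ → φ s ≠ 0 →
      leadExps m (J.map (MvPolynomial.map φ)) = leadExps m J := by
  classical
  have key : ∀ u ∈ minGens (leadExps m J), ∃ g ∈ J, g ≠ 0 ∧ m.degree g = u :=
    fun u hu => minGens_subset _ hu
  choose! g hgJ hg0 hgd using key
  have hfin := minGens_finite (leadExps m J)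
  -- It suffices to keep alive the leading coefficients of finitely many elements, one for each
  -- minimal generator.
  refine ⟨∏ u ∈ hfin.toFinset, m.leadingCoeff (g u), ?_, fun φ hsurj hs => ?_⟩
  · refine Finset.prod_ne_zero_iff.2 fun u hu => ?_
    exact m.leadingCoeff_ne_zero_iff.2 (hg0 u (hfin.mem_toFinset.1 hu))
  rw [map_prod, Finset.prod_ne_zero_iff] at hs
  have hs : ∀ u ∈ minGens (leadExps m J), φ (m.leadingCoeff (g u)) ≠ 0 :=
    fun u hu => hs u (hfin.mem_toFinset.2 hu)
  ext w
  constructor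
  · rintro ⟨p, hp, hp0, rfl⟩
    obtain ⟨f, hf, rfl⟩ := (Ideal.mem_map_iff_of_surjective _ (map_surjective φ hsurj)).1 hp
    exact degree_map_mem_of_forall_minGens m J
      (fun u hu => ⟨g u, hgJ u hu, hgd u hu, hs u hu⟩) f hf hp0
  · intro hw
    obtain ⟨u, hu, huw⟩ := exists_minGens_le hw
    have h := degree_map_of_ne_zero (hs u hu)
    refine isUpperSet_leadExps m _ huw ⟨_, Ideal.mem_map_of_mem _ (hgJ u hu), h.1, ?_⟩
    rw [h.2, hgd u hu]

end Specialization


/-! ### A derivation preserving the transvection family -/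

section CoefficientDerivative

variable {σ K : Type*} [Field K]

/-- The derivative of a polynomial with respect to the parameter in its coefficients. -/
noncomputable def coeffDerivative (P : MvPolynomial σ (Polynomial K)) :
    MvPolynomial σ (Polynomial K) :=
  ∑ u ∈ P.support, monomial u (Polynomial.derivative (P.coeff u))

@[simp]
theorem coeff_coeffDerivative (P : MvPolynomial σ (Polynomial K)) (u : σ →₀ ℕ) :
    (coeffDerivative P).coeff u = Polynomial.derivative (P.coeff u) := by
  classical
  unfold coeffDerivative
  rw [coeff_sum]
  simp only [coeff_monomial]
  rw [Finset.sum_ite_eq']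
  split_ifs with h
  · rfl
  · rw [notMem_support_iff.1 h, map_zero]

theorem coeffDerivative_add (P Q : MvPolynomial σ (Polynomial K)) :
    coeffDerivative (P + Q) = coeffDerivative P + coeffDerivative Q := by
  ext1 u; simp

theorem coeffDerivative_mul (P Q : MvPolynomial σ (Polynomial K)) :
    coeffDerivative (P * Q) = coeffDerivative P * Q + P * coeffDerivative Q := by
  classical
  ext1 u
  simp [coeff_mul, Finset.sum_add_distrib, Polynomial.derivative_mul]

theorem coeffDerivative_C (c : Polynomial K) :
    coeffDerivative (C c : MvPolynomial σ (Polynomial K)) = C (Polynomial.derivative c) := by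
  classical
  ext1 u
  simp only [coeff_coeffDerivative, coeff_C]
  split_ifs <;> simp

theorem coeffDerivative_X (j : σ) :
    coeffDerivative (X j : MvPolynomial σ (Polynomial K)) = 0 := by
  classical
  ext1 u
  simp only [coeff_coeffDerivative, coeff_X, coeff_zero]
  split_ifs <;> simp

variable (i j : σ)

/-- The derivation `∂/∂t - x_i ∂/∂x_j` of `K[t][x]`. -/
noncomputable def transvectionConnection (P : MvPolynomial σ (Polynomial K)) :
    MvPolynomial σ (Polynomial K) :=
  coeffDerivative P - X i * pderiv j P

theorem transvectionConnection_add (P Q : MvPolynomial σ (Polynomial K)) :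
    transvectionConnection i j (P + Q) =
      transvectionConnection i j P + transvectionConnection i j Q := by
  simp only [transvectionConnection, coeffDerivative_add, map_add]
  ring

theorem transvectionConnection_mul (P Q : MvPolynomial σ (Polynomial K)) :
    transvectionConnection i j (P * Q) =
      transvectionConnection i j P * Q + P * transvectionConnection i j Q := by
  simp only [transvectionConnection, coeffDerivative_mul, pderiv_mul]
  ring

open Classical in
/-- The one-parameter family `x_j ↦ x_j + t x_i` of linear changes of variables. -/
noncomputable def transvectionFamily : MvPolynomial σ K →+* MvPolynomial σ (Polynomial K) :=
  eval₂Hom (C.comp Polynomial.C) fun k => X k + if k = j then C Polynomial.X * X i else 0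

variable {i j}

/-- Chain rule: differentiating `p(x_j + t x_i)` in t gives `x_i` times its derivative in `x_j`. As
the operator is a derivation, constants and variables suffice. -/
theorem transvectionConnection_transvectionFamily (hij : i ≠ j) (p : MvPolynomial σ K) :
    transvectionConnection i j (transvectionFamily i j p) = 0 := by
  classical
  induction p using MvPolynomial.induction_on with
  | C a => simp [transvectionFamily, transvectionConnection, coeffDerivative_C]
  | add p q hp hq => rw [map_add, transvectionConnection_add, hp, hq, add_zero]
  | mul_X p k hp =>
    rw [map_mul, transvectionConnection_mul, hp, zero_mul, zero_add]
    refine mul_eq_zero_of_right _ ?_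
    simp only [transvectionFamily, coe_eval₂Hom, eval₂_X]
    split_ifs with hk
    · subst hk
      simp [transvectionConnection, coeffDerivative_add, coeffDerivative_mul, coeffDerivative_C,
        coeffDerivative_X, pderiv_X_of_ne hij]
    · simp [transvectionConnection, coeffDerivative_X, pderiv_X_of_ne hk]

/-- The extended ideal has generators killed by the derivation, so the Leibniz rule keeps it inside
itself. -/
theorem transvectionConnection_mem (hij : i ≠ j) (J : Ideal (MvPolynomial σ K))
    {P : MvPolynomial σ (Polynomial K)} (hP : P ∈ J.map (transvectionFamily i j)) :
    transvectionConnection i j P ∈ J.map (transvectionFamily i j) := by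
  refine Submodule.span_induction (p := fun P _ => transvectionConnection i j P ∈ _)
    ?_ ?_ ?_ ?_ hP
  · rintro _ ⟨p, -, rfl⟩
    rw [transvectionConnection_transvectionFamily hij]
    exact Ideal.zero_mem _
  · simp [transvectionConnection, coeffDerivative]
  · intro P Q _ _ hP hQ
    rw [transvectionConnection_add]
    exact Ideal.add_mem _ hP hQ
  · intro a P hPm hP
    rw [smul_eq_mul, transvectionConnection_mul]
    exact Ideal.add_mem _ (Ideal.mul_mem_left _ _ hPm) (Ideal.mul_mem_left _ _ hP)

end CoefficientDerivative

/-! ### Galligo's theorem -/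

section StronglyStable

variable {n : ℕ} (m : MonomialOrder (Fin n)) {K : Type*} [Field K]

/-- In a transvection family, generic leading monomials are closed under the replacement of a
variable by the larger one. -/
theorem leadExps_map_transvectionFamily_exchange [CharZero K] {i j : Fin n}
    (hlt : m.toSyn (Finsupp.single j 1) < m.toSyn (Finsupp.single i 1))
    (J : Ideal (MvPolynomial (Fin n) K)) {v : Mon n}
    (hv : v + Finsupp.single j 1 ∈ leadExps m (J.map (transvectionFamily i j))) :
    v + Finsupp.single i 1 ∈ leadExps m (J.map (transvectionFamily i j)) := by
  classical
  have hij : i ≠ j := by rintro rfl; exact lt_irrefl _ hlt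
  obtain ⟨P, hP, hP0, hPd⟩ := hv
  have hlt' : m.toSyn (v + Finsupp.single j 1) < m.toSyn (v + Finsupp.single i 1) := by
    simpa only [map_add, add_lt_add_iff_left] using hlt
  have hz : P.coeff (v + Finsupp.single i 1) = 0 := m.coeff_eq_zero_of_lt (by rwa [hPd])
  -- The coefficient is `-(v j + 1)` times the leading coefficient of `P`; characteristic zero is
  -- what keeps it nonzero.
  have hc : (transvectionConnection i j P).coeff (v + Finsupp.single i 1) ≠ 0 := by
    rw [transvectionConnection, coeff_sub, coeff_coeffDerivative, hz, map_zero, zero_sub,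
      mul_comm, coeff_mul_X, coeff_pderiv, neg_ne_zero, ← hPd]
    exact mul_ne_zero (m.coeff_degree_ne_zero_iff.2 hP0) (Nat.cast_add_one_ne_zero _)
  refine ⟨_, transvectionConnection_mem hij J hP, fun h => hc (by simp [h]),
    degree_eq_of_forall_le hc fun w hw => ?_⟩
  have hle : ∀ u, P.coeff u ≠ 0 → m.toSyn u ≤ m.toSyn (v + Finsupp.single j 1) := fun u hu => by
    rw [← hPd]; exact m.le_degree (mem_support_iff.2 hu)
  by_cases h1 : P.coeff w = 0
  · rw [mem_support_iff, transvectionConnection, coeff_sub, coeff_coeffDerivative, h1, map_zero,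
      zero_sub, neg_ne_zero, coeff_X_mul'] at hw
    split_ifs at hw with hwi
    · rw [coeff_pderiv] at hw
      have h2 := hle _ (left_ne_zero_of_mul hw)
      have h3 : Finsupp.single i 1 ≤ w := by
        rw [Finsupp.single_le_iff]
        exact Nat.one_le_iff_ne_zero.2 (Finsupp.mem_support_iff.1 hwi)
      rw [map_add, map_add, add_le_add_iff_right] at h2
      rw [← tsub_add_cancel_of_le h3, map_add, map_add]
      exact add_le_add_left h2 _
    · exact absurd rfl hw
  · exact (hle w h1).trans hlt'.le

theorem map_eval_comp_transvectionFamily (i j : Fin n) (c : K)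
    (A : GL (Fin n) K) (hA : (A : Matrix (Fin n) (Fin n) K) = Matrix.transvection i j c) :
    (MvPolynomial.map (Polynomial.evalRingHom c)).comp (transvectionFamily i j) =
      (linChange A : MvPolynomial (Fin n) K →+* MvPolynomial (Fin n) K) := by
  classical
  refine MvPolynomial.ringHom_ext (fun a => ?_) fun k => ?_
  · simp [transvectionFamily, linChange]
  · simp only [transvectionFamily, linChange, hA, RingHom.comp_apply, coe_eval₂Hom, eval₂_X,
      RingHom.coe_coe, aeval_X, Matrix.transvection, Matrix.add_apply, map_add, add_mul,
      Finset.sum_add_distrib, map_X]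
    congr 1
    · rw [Finset.sum_eq_single k] <;> simp +contextual
    · by_cases hk : k = j
      · subst hk
        rw [Finset.sum_eq_single i] <;> simp +contextual [Matrix.single_apply]
        grind
      · rw [if_neg hk, map_zero]
        symm
        refine Finset.sum_eq_zero fun l _ => ?_
        simp [Ne.symm hk]

theorem linChange_mul (A B : GL (Fin n) K) :
    linChange (A * B) = (linChange A).comp (linChange B) := by
  ext1 k
  simp only [linChange, aeval_X, AlgHom.comp_apply, map_sum, map_mul, algHom_C,
    Units.val_mul, Matrix.mul_apply, Finset.mul_sum, Finset.sum_mul, algebraMap_eq]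
  rw [Finset.sum_comm]
  refine Finset.sum_congr rfl fun l _ => Finset.sum_congr rfl fun i _ => ?_
  ring

/-- Along the line of transvections times `A`, a polynomial witnessing `A ∈ U` becomes a polynomial
in `c`, nonzero at `c = 0`. Its product with `s` has a nonroot because `K` is infinite. -/
theorem exists_transvection_mul_mem [CharZero K] {U : Set (GL (Fin n) K)} (hU : IsZariskiOpen U)
    {A : GL (Fin n) K} (hA : A ∈ U) {i j : Fin n} (hij : i ≠ j) {s : Polynomial K} (hs : s ≠ 0) :
    ∃ (c : K) (B : GL (Fin n) K), s.eval c ≠ 0 ∧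
      (B : Matrix (Fin n) (Fin n) K) = Matrix.transvection i j c ∧ B * A ∈ U := by
  obtain ⟨S, rfl⟩ := hU
  obtain ⟨p, hp, hpA⟩ := hA
  set q : Polynomial K := eval₂ Polynomial.C (fun kl =>
    (Matrix.transvection i j (Polynomial.X : Polynomial K) *
      (A : Matrix (Fin n) (Fin n) K).map Polynomial.C) kl.1 kl.2) p with hq
  have hqe : ∀ c, q.eval c = eval (fun kl =>
      (Matrix.transvection i j c * (A : Matrix (Fin n) (Fin n) K)) kl.1 kl.2) p := by
    intro c
    rw [hq, ← Polynomial.coe_evalRingHom, eval₂_comp_left, eval, coe_eval₂Hom]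
    congr 1
    · ext; simp
    · ext kl
      simp only [Function.comp_apply, Matrix.mul_apply, map_sum, map_mul]
      refine Finset.sum_congr rfl fun l _ => ?_
      simp only [Matrix.transvection, Matrix.add_apply, Matrix.one_apply, Matrix.single_apply,
        Matrix.map_apply, map_add, Polynomial.coe_evalRingHom, Polynomial.eval_C]
      split_ifs <;> simp
  have hq0 : q ≠ 0 := by
    intro h0
    have := hqe 0
    rw [h0, Polynomial.eval_zero, Matrix.transvection_zero, one_mul] at this
    exact hpA this.symm
  obtain ⟨c, hc⟩ := Polynomial.exists_eval_ne_zero_of_natDegree_lt_card (s * q)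
    (mul_ne_zero hs hq0) (by
      have : Infinite K := CharZero.infinite K
      exact Cardinal.natCast_lt_aleph0.trans_le (Cardinal.aleph0_le_mk K))
  rw [Polynomial.eval_mul] at hc
  have hdet : (Matrix.transvection i j c).det ≠ 0 := by
    rw [Matrix.det_transvection_of_ne i j hij]; exact one_ne_zero
  refine ⟨c, Matrix.GeneralLinearGroup.mkOfDetNeZero _ hdet, left_ne_zero_of_mul hc, rfl,
    p, hp, ?_⟩
  have := right_ne_zero_of_mul hc
  rwa [hqe] at this

/-- **Galligo's theorem**: in characteristic zero the leading monomials of an ideal in generic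
position are closed under replacing a variable by a larger one. -/
theorem IsInGenericPosition.exchange [CharZero K] {I : Ideal (MvPolynomial (Fin n) K)}
    (hI : IsInGenericPosition m I) {i j : Fin n}
    (hlt : m.toSyn (Finsupp.single j 1) < m.toSyn (Finsupp.single i 1)) {v : Mon n}
    (hv : v + Finsupp.single j 1 ∈ leadExps m I) : v + Finsupp.single i 1 ∈ leadExps m I := by
  have hij : i ≠ j := by rintro rfl; exact lt_irrefl _ hlt
  obtain ⟨U, hU, ⟨A, hA⟩, hin⟩ := hI
  set J := I.map (linChange A)
  obtain ⟨s, hs, hspec⟩ :=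
    exists_leadExps_map_eq (K := K) m (J.map (transvectionFamily i j))
  obtain ⟨c, B, hc, hB, hBA⟩ := exists_transvection_mul_mem hU hA hij hs
  -- The value `c` is good for two reasons at once: it preserves the leading exponents of the
  -- family, and `B * A` stays in `U`, where the initial ideal is that of `I`.
  have hgen : leadExps m (J.map (transvectionFamily i j)) = leadExps m I := by
    rw [← hspec (Polynomial.evalRingHom c) (fun a => ⟨Polynomial.C a, by simp⟩) hc,
      Ideal.map_map, map_eval_comp_transvectionFamily i j c B hB]
    have hJ : J.map (linChange B : MvPolynomial (Fin n) K →+* MvPolynomial (Fin n) K) =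
        I.map (linChange (B * A)) := by
      rw [linChange_mul]
      exact Ideal.map_map _ _
    ext u
    rw [mem_leadExps_iff, mem_leadExps_iff, hJ, hin _ hBA]
  rw [← hgen] at hv ⊢
  exact leadExps_map_transvectionFamily_exchange m hlt J hv

end StronglyStable


/-! ### Pommaret and Janet divisors -/

section InvolutiveDivision

variable {n : ℕ}

theorem invDvd_add_iff {M : Mon n → Fin n → Prop} {u a : Mon n} :
    InvDvd M u (u + a) ↔ ∀ i, a i ≠ 0 → M u i := by
  simp [InvDvd, Nat.pos_iff_ne_zero]

theorem invDvd_refl (M : Mon n → Fin n → Prop) (u : Mon n) : InvDvd M u u :=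
  ⟨le_rfl, fun _ h => absurd h (lt_irrefl _)⟩

/-- Two Pommaret divisors of a monomial divide one another. -/
theorem InvDvd.pommaret_total {u v t : Mon n} (hu : InvDvd PommaretMult u t)
    (hv : InvDvd PommaretMult v t) : InvDvd PommaretMult u v ∨ InvDvd PommaretMult v u := by
  by_cases huv : u ≤ v
  · exact Or.inl ⟨huv, fun i hi => hu.2 i (hi.trans_le (hv.1 i))⟩
  by_cases hvu : v ≤ u
  · exact Or.inr ⟨hvu, fun i hi => hv.2 i (hi.trans_le (hu.1 i))⟩
  exfalso
  rw [Finsupp.le_def] at huv hvu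
  push Not at huv hvu
  obtain ⟨a, ha⟩ := huv
  obtain ⟨b, hb⟩ := hvu
  have hba : b ≤ a := hv.2 a (ha.trans_le (hu.1 a)) b (by omega)
  have hab : a ≤ b := hu.2 b (hb.trans_le (hv.1 b)) a (by omega)
  obtain rfl := le_antisymm hab hba
  omega

/-- Every monomial has at most one Janet divisor. -/
theorem InvDvd.janet_unique {U : Set (Mon n)} {u v t : Mon n} (huU : u ∈ U) (hvU : v ∈ U)
    (hu : InvDvd (JanetMult U) u t) (hv : InvDvd (JanetMult U) v t) : u = v := by
  ext l
  induction l using WellFoundedLT.induction with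
  | ind l ih =>
  rcases lt_trichotomy (u l) (v l) with h | h | h
  · have := hu.2 l (h.trans_le (hv.1 l)) v hvU fun j hj => (ih j hj).symm
    omega
  · exact h
  · have := hv.2 l (h.trans_le (hu.1 l)) u huU ih
    omega

/-- Continuity of the Janet division. At a first deficit `l`, `v` would have maximal degree in its
class, but `u` (for `l < i`) or a witness that `x_i` is nonmultiplicative for `u` (for `l = i`)
exceeds it. Consequently `v` is lexicographically larger than `u`. -/
theorem InvDvd.janet_prolongation {U : Set (Mon n)} {u v : Mon n} (huU : u ∈ U) {i : Fin n}
    (hi : ¬ JanetMult U u i) (hv : InvDvd (JanetMult U) v (u + Finsupp.single i 1)) :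
    ∀ l ≤ i, v l = (u + Finsupp.single i 1 : Mon n) l := by
  intro l
  induction l using WellFoundedLT.induction with
  | ind l ih =>
  intro hl
  refine le_antisymm (hv.1 l) (not_lt.1 fun hlt => ?_)
  have hmult := hv.2 l hlt
  have hprev : ∀ j < l, u j = v j := fun j hj => by
    rw [ih j hj (hj.le.trans hl), Finsupp.add_apply,
      Finsupp.single_eq_of_ne (hj.trans_le hl).ne, add_zero]
  rcases hl.lt_or_eq with h | rfl
  · have := hmult u huU hprev
    rw [Finsupp.add_apply, Finsupp.single_eq_of_ne h.ne] at hlt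
    omega
  · simp only [JanetMult, not_forall, not_le] at hi
    obtain ⟨w, hw, hwu, hlw⟩ := hi
    have := hmult w hw fun j hj => (hwu j hj).trans (hprev j hj)
    rw [Finsupp.add_apply, Finsupp.single_eq_same] at hlt
    omega

/-- A deficit at `l ≤ i` confines the variables of `v` to indices at most `l`. Then `v` is already a
Pommaret divisor of `u`, so `v = u`, and `x_i` would be multiplicative for `u`. The hypothesis `huv`
is supplied by autoreduction. -/
theorem InvDvd.pommaret_prolongation {u v : Mon n} {i : Fin n} (hi : ¬ PommaretMult u i)
    (hv : InvDvd PommaretMult v (u + Finsupp.single i 1))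
    (huv : InvDvd PommaretMult v u → v = u) :
    ∀ l ≤ i, v l = (u + Finsupp.single i 1 : Mon n) l := by
  intro l hl
  refine le_antisymm (hv.1 l) (not_lt.1 fun hlt => ?_)
  have hmult := hv.2 l hlt
  have hle : v ≤ u := by
    intro k
    have hk := hv.1 k
    rcases eq_or_ne k i with rfl | hne
    · by_contra hcon
      have : k = l := le_antisymm (hmult k (by omega)) hl
      subst this
      rw [Finsupp.add_apply, Finsupp.single_eq_same] at hlt
      omega
    · rwa [Finsupp.add_apply, Finsupp.single_eq_of_ne hne, add_zero] at hk
  obtain rfl := huv ⟨hle, fun k hk => hv.2 k (hk.trans_le (by simp))⟩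
  exact hi fun j hj => (hmult j hj).trans hl

end InvolutiveDivision

/-! ### Involutive bases and the covering property -/

section InvolutiveBasis

variable {K : Type*} [Field K] {n : ℕ} {m : MonomialOrder (Fin n)}

theorem degree_lt_of_coeff_eq_zero {r : MvPolynomial (Fin n) K} {d : Mon n} (hr : r ≠ 0)
    (hle : m.toSyn (m.degree r) ≤ m.toSyn d) (hd : r.coeff d = 0) :
    m.toSyn (m.degree r) < m.toSyn d :=
  lt_of_le_of_ne hle fun h =>
    m.coeff_degree_ne_zero_iff.2 hr (by rwa [m.toSyn.injective h])

/-- If a vector space of polynomials is spanned by polynomials with distinct leading monomials,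
then all leading monomials of its elements are among these. -/
theorem exists_degree_eq_of_mem_span {ι : Type*} {p : ι → MvPolynomial (Fin n) K}
    (hp : ∀ i, p i ≠ 0) (hinj : Function.Injective fun i => m.degree (p i))
    {h : MvPolynomial (Fin n) K} (hh : h ∈ Submodule.span K (Set.range p)) (h0 : h ≠ 0) :
    ∃ i, m.degree h = m.degree (p i) := by
  obtain ⟨c, rfl⟩ := Finsupp.mem_span_range_iff_exists_finsupp.1 hh
  have hne : c.support.Nonempty := by
    rw [Finset.nonempty_iff_ne_empty]
    intro hc
    exact h0 (by simp [Finsupp.sum, hc])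
  obtain ⟨i, hi, hmax⟩ := c.support.exists_max_image (fun i => m.toSyn (m.degree (p i))) hne
  refine ⟨i, degree_eq_of_forall_le ?_ ?_⟩
  · rw [Finsupp.sum, coeff_sum, Finset.sum_eq_single i]
    · rw [coeff_smul]
      exact mul_ne_zero (Finsupp.mem_support_iff.1 hi) (m.coeff_degree_ne_zero_iff.2 (hp i))
    · intro j hj hji
      rw [coeff_smul, m.coeff_eq_zero_of_lt, smul_zero]
      exact lt_of_le_of_ne (hmax j hj) fun h => hji (hinj (m.toSyn.injective h))
    · exact fun h => absurd hi h
  · refine m.degree_le_iff.1 (m.degree_sum_le.trans (Finset.sup_le fun j hj => ?_))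
    exact m.degree_smul_le.trans (hmax j hj)

/-- A reduction chain is a representation by multiplicative multiples; the bound `d` on their
leading monomials drives the later induction. -/
theorem InvStep.sub_mem_span {M : Mon n → Fin n → Prop} {F : Set (MvPolynomial (Fin n) K)}
    {h r : MvPolynomial (Fin n) K} (hr : Relation.ReflTransGen (InvStep m M F) h r) {d : Mon n}
    (hd : m.toSyn (m.degree h) ≤ m.toSyn d) :
    m.toSyn (m.degree r) ≤ m.toSyn d ∧
    h - r ∈ Submodule.span K {p | ∃ g ∈ F, ∃ a, InvDvd M (m.degree g) (m.degree g + a) ∧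
      m.toSyn (a + m.degree g) ≤ m.toSyn d ∧ p = monomial a (1 : K) * g} := by
  induction hr with
  | refl => simpa using hd
  | @tail x y _ hxy ih =>
    obtain ⟨f, hf, t, ht, hdvd, rfl⟩ := hxy
    have htd : m.toSyn t ≤ m.toSyn d := (m.le_degree ht).trans ih.1
    have hadd : t - m.degree f + m.degree f = t := tsub_add_cancel_of_le hdvd.1
    constructor
    · refine m.degree_sub_le.trans (max_le ih.1 (m.degree_mul_le.trans ?_))
      refine le_trans ?_ htd
      conv_rhs => rw [← hadd]
      rw [map_add, map_add]
      exact add_le_add_left (m.degree_monomial_le _) _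
    · rw [← sub_add]
      refine Submodule.add_mem _ ih.2 ?_
      have : monomial (t - m.degree f) (x.coeff t / m.leadingCoeff f) * f =
          (x.coeff t / m.leadingCoeff f) • (monomial (t - m.degree f) (1 : K) * f) := by
        rw [← smul_mul_assoc, smul_monomial, smul_eq_mul, mul_one]
      rw [this]
      refine Submodule.smul_mem _ _ (Submodule.subset_span ⟨f, hf, _, ?_, ?_, rfl⟩)
      · rwa [add_comm, hadd]
      · rwa [hadd]

variable {M : Mon n → Fin n → Prop} {I : Ideal (MvPolynomial (Fin n) K)}
  {F : Set (MvPolynomial (Fin n) K)}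

/-- For a continuous involutive division, the multiplicative multiples of the elements of an
involutive basis span the ideal. -/
theorem IsInvBasis.monomial_mul_mem_span (hF : IsInvBasis m M I F)
    (hcont : ∀ f ∈ F, ∀ i, ¬ M (m.degree f) i → ∀ g ∈ F,
      InvDvd M (m.degree g) (m.degree f + Finsupp.single i 1) →
      ∀ l ≤ i, m.degree g l = (m.degree f + Finsupp.single i 1 : Mon n) l)
    (a : Mon n) {f : MvPolynomial (Fin n) K} (hf : f ∈ F) :
    monomial a (1 : K) * f ∈ Submodule.span K
      {p | ∃ g ∈ F, ∃ a, InvDvd M (m.degree g) (m.degree g + a) ∧ p = monomial a (1 : K) * g} := by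
  set V := Submodule.span K
    {p | ∃ g ∈ F, ∃ a, InvDvd M (m.degree g) (m.degree g + a) ∧ p = monomial a (1 : K) * g}
  induction hw : m.toSyn (a + m.degree f) using WellFoundedLT.induction generalizing a f with
  | ind s ih =>
  obtain ⟨w, rfl⟩ := m.toSyn.surjective s
  -- Inner induction for a fixed leading monomial `w` of the product: `m.degree f` climbs
  -- lexicographically through the finitely many divisors of `w`.
  have hwf := (Set.finite_Iic w).wellFoundedOn (r := fun u v : Mon n => toLex v < toLex u)
  have key : ∀ u ∈ Set.Iic w, ∀ (a : Mon n) (f : MvPolynomial (Fin n) K), f ∈ F →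
      m.degree f = u → a + m.degree f = w → monomial a (1 : K) * f ∈ V := by
    intro u hu
    refine hwf.induction (P := fun u => ∀ (a : Mon n) (f : MvPolynomial (Fin n) K), f ∈ F →
      m.degree f = u → a + m.degree f = w → monomial a (1 : K) * f ∈ V) hu fun u hu ihu => ?_
    rintro a f hf rfl rfl
    by_cases hmult : ∀ i, a i ≠ 0 → M (m.degree f) i
    · exact Submodule.subset_span ⟨f, hf, a, invDvd_add_iff.2 hmult, rfl⟩
    push Not at hmult
    obtain ⟨i, hai, hi⟩ := hmult
    obtain ⟨b, rfl⟩ : ∃ b, a = b + Finsupp.single i 1 :=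
      ⟨a - Finsupp.single i 1, (tsub_add_cancel_of_le
        (Finsupp.single_le_iff.2 (Nat.one_le_iff_ne_zero.2 hai))).symm⟩
    have hf0 : f ≠ 0 := fun h => hF.zero_notMem (h ▸ hf)
    have hdeg : m.degree (f * X i) = m.degree f + Finsupp.single i 1 := by
      rw [m.degree_mul hf0 (X_ne_zero i), m.degree_X]
    have hred := (InvStep.sub_mem_span (hF.prolongation f hf i hi).1 le_rfl).2
    rw [sub_zero, hdeg] at hred
    have hrw : monomial (b + Finsupp.single i 1) (1 : K) * f =
        LinearMap.mulLeft K (monomial b (1 : K)) (f * X i) := by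
      rw [LinearMap.mulLeft_apply, X, mul_comm f, ← mul_assoc, monomial_mul, one_mul]
    rw [hrw]
    refine (Submodule.map_le_iff_le_comap.2 (Submodule.span_le.2 ?_) :
      Submodule.map (LinearMap.mulLeft K (monomial b (1 : K))) _ ≤ V)
      (Submodule.mem_map_of_mem hred)
    rintro _ ⟨g, hg, c, hgc, hle, rfl⟩
    rw [SetLike.mem_coe, Submodule.mem_comap, LinearMap.mulLeft_apply, ← mul_assoc, monomial_mul,
      one_mul]
    -- Smaller summands fall to the outer induction. A summand with the same leading monomial has a
    -- `g` whose leading monomial is lexicographically larger than that of `f`, by continuity.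
    rcases hle.lt_or_eq with hlt | heq
    · refine ih _ ?_ (b + c) hg rfl
      have := add_lt_add_right hlt (m.toSyn b)
      simp only [map_add] at this ⊢
      convert this using 1 <;> abel
    · have heq := m.toSyn.injective heq
      have hsum : b + c + m.degree g = b + Finsupp.single i 1 + m.degree f := by
        rw [add_assoc, heq]; abel
      refine ihu (m.degree g) ?_ ?_ (b + c) g hg rfl hsum
      · rw [Set.mem_Iic, ← hsum]
        exact le_add_self
      · have hgl := hcont f hf i hi g hg (by rwa [← heq, add_comm])
        refine Finsupp.Lex.lt_iff.2 ⟨i, fun j hj => ?_, ?_⟩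
        · have := hgl j hj.le
          rw [Finsupp.add_apply, Finsupp.single_eq_of_ne hj.ne, add_zero] at this
          exact this.symm
        · have := hgl i le_rfl
          rw [Finsupp.add_apply, Finsupp.single_eq_same] at this
          simp [this]
  have hw' := m.toSyn.injective hw
  exact key (m.degree f) (by rw [Set.mem_Iic, ← hw']; exact le_add_self) a f hf rfl hw'

/-- The leading monomials of an involutive basis for a continuous division are involutive
divisors of all leading monomials of the ideal. -/
theorem IsInvBasis.exists_invDvd (hF : IsInvBasis m M I F)
    (hcont : ∀ f ∈ F, ∀ i, ¬ M (m.degree f) i → ∀ g ∈ F,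
      InvDvd M (m.degree g) (m.degree f + Finsupp.single i 1) →
      ∀ l ≤ i, m.degree g l = (m.degree f + Finsupp.single i 1 : Mon n) l)
    (huniq : ∀ f ∈ F, ∀ g ∈ F, ∀ t, InvDvd M (m.degree f) t → InvDvd M (m.degree g) t → f = g)
    {w : Mon n} (hw : w ∈ leadExps m I) : ∃ f ∈ F, InvDvd M (m.degree f) w := by
  classical
  obtain ⟨h, hh, h0, rfl⟩ := hw
  have hne : ∀ f ∈ F, f ≠ 0 := fun f hf h => hF.zero_notMem (h ▸ hf)
  have hdeg : ∀ f ∈ F, ∀ a, m.degree (monomial a (1 : K) * f) = m.degree f + a := by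
    intro f hf a
    rw [m.degree_mul (by simp) (hne f hf), m.degree_monomial, if_neg one_ne_zero, add_comm]
  -- The multiplier `q` is needed for the induction, since the `K`-span is not known to be an ideal.
  have hall : ∀ q, q * h ∈ Submodule.span K
      {p | ∃ g ∈ F, ∃ a, InvDvd M (m.degree g) (m.degree g + a) ∧
        p = monomial a (1 : K) * g} := by
    rw [← hF.span_eq] at hh
    refine Submodule.span_induction (p := fun x _ => ∀ q, q * x ∈ _) ?_ ?_ ?_ ?_ hh
    · intro f hf q
      induction q using MvPolynomial.induction_on' with
      | monomial a c =>
        have : monomial a c * f = c • (monomial a (1 : K) * f) := by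
          rw [← smul_mul_assoc, smul_monomial, smul_eq_mul, mul_one]
        rw [this]
        exact Submodule.smul_mem _ _ (hF.monomial_mul_mem_span hcont a hf)
      | add p q hp hq =>
        rw [add_mul]
        exact Submodule.add_mem _ hp hq
    · simp
    · intro x y _ _ hx hy q
      rw [mul_add]
      exact Submodule.add_mem _ (hx q) (hy q)
    · intro a x _ hx q
      rw [smul_eq_mul, ← mul_assoc]
      exact hx _
  have hmem := hall 1
  rw [one_mul] at hmem
  let ι := {x : MvPolynomial (Fin n) K × Mon n //
    x.1 ∈ F ∧ InvDvd M (m.degree x.1) (m.degree x.1 + x.2)}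
  let p : ι → MvPolynomial (Fin n) K := fun x => monomial x.1.2 1 * x.1.1
  have hrange : {p | ∃ g ∈ F, ∃ a, InvDvd M (m.degree g) (m.degree g + a) ∧
      p = monomial a (1 : K) * g} = Set.range p := by
    ext q
    constructor
    · rintro ⟨g, hg, a, ha, rfl⟩
      exact ⟨⟨(g, a), hg, ha⟩, rfl⟩
    · rintro ⟨⟨⟨g, a⟩, hg, ha⟩, rfl⟩
      exact ⟨g, hg, a, ha, rfl⟩
  rw [hrange] at hmem
  have hinj : Function.Injective fun x => m.degree (p x) := by
    rintro ⟨⟨f, a⟩, hf, ha⟩ ⟨⟨g, b⟩, hg, hb⟩ hfg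
    simp only [p, hdeg f hf, hdeg g hg] at hfg
    obtain rfl : f = g := huniq f hf g hg _ ha (hfg ▸ hb)
    obtain rfl : a = b := by simpa using hfg
    rfl
  obtain ⟨⟨⟨f, a⟩, hf, ha⟩, hx⟩ := exists_degree_eq_of_mem_span
    (fun x => mul_ne_zero (by simp) (hne _ x.2.1)) hinj hmem h0
  refine ⟨f, hf, ?_⟩
  rw [hx, hdeg f hf]
  exact ha

theorem IsInvBasis.degree_mem (hF : IsInvBasis m M I F) {f : MvPolynomial (Fin n) K}
    (hf : f ∈ F) : m.degree f ∈ leadExps m I :=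
  ⟨f, hF.span_eq ▸ Ideal.subset_span hf, fun h => hF.zero_notMem (h ▸ hf), rfl⟩

theorem IsInvBasis.eq_of_invDvd (hF : IsInvBasis m M I F) {f g : MvPolynomial (Fin n) K}
    (hf : f ∈ F) (hg : g ∈ F) (h : InvDvd M (m.degree g) (m.degree f)) : g = f := by
  by_contra hne
  refine hF.autoreduced f hf g hg hne _ (m.degree_mem_support ?_) h
  exact fun h => hF.zero_notMem (h ▸ hf)

theorem IsPommaretBasis.exists_invDvd (hF : IsPommaretBasis m I F) {w : Mon n}
    (hw : w ∈ leadExps m I) : ∃ f ∈ F, InvDvd PommaretMult (m.degree f) w := by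
  refine IsInvBasis.exists_invDvd hF ?_ ?_ hw
  · intro f hf i hi g hg hdvd
    exact hdvd.pommaret_prolongation hi fun h => by rw [hF.eq_of_invDvd hf hg h]
  · intro f hf g hg t hft hgt
    rcases hft.pommaret_total hgt with h | h
    · exact hF.eq_of_invDvd hg hf h
    · exact (hF.eq_of_invDvd hf hg h).symm

theorem IsJanetBasis.exists_invDvd (hF : IsJanetBasis m I F) {w : Mon n}
    (hw : w ∈ leadExps m I) : ∃ f ∈ F, InvDvd (JanetMult (lmSet m F)) (m.degree f) w := by
  refine IsInvBasis.exists_invDvd hF.2 ?_ ?_ hw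
  · intro f hf i hi g hg hdvd
    exact hdvd.janet_prolongation (U := lmSet m F) ⟨f, hf, rfl⟩ hi
  · intro f hf g hg t hft hgt
    refine hF.2.eq_of_invDvd hg hf ?_
    rw [InvDvd.janet_unique (U := lmSet m F) ⟨f, hf, rfl⟩ ⟨g, hg, rfl⟩ hft hgt]
    exact invDvd_refl _ _

/-- If the leading monomials of `F` are involutive divisors of all leading monomials of the ideal,
then all its elements are involutively reducible to zero. -/
theorem reflTransGen_invStep_zero (hFI : F ⊆ I) (hF0 : (0 : MvPolynomial (Fin n) K) ∉ F)
    (hcov : ∀ w ∈ leadExps m I, ∃ f ∈ F, InvDvd M (m.degree f) w)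
    {h : MvPolynomial (Fin n) K} (hh : h ∈ I) : Relation.ReflTransGen (InvStep m M F) h 0 := by
  by_cases h0 : h = 0
  · rw [h0]
  induction hd : m.toSyn (m.degree h) using WellFoundedLT.induction generalizing h with
  | ind d ih =>
  subst hd
  obtain ⟨f, hf, hdvd⟩ := hcov _ ⟨h, hh, h0, rfl⟩
  have hf0 : f ≠ 0 := fun h => hF0 (h ▸ hf)
  set r := h - monomial (m.degree h - m.degree f)
    (h.coeff (m.degree h) / m.leadingCoeff f) * f with hr
  have hstep : InvStep m M F h r := ⟨f, hf, _, m.degree_mem_support h0, hdvd, rfl⟩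
  refine Relation.ReflTransGen.head hstep ?_
  by_cases hr0 : r = 0
  · rw [hr0]
  refine ih _ ?_ (I.sub_mem hh (I.mul_mem_left _ (hFI hf))) hr0 rfl
  refine degree_lt_of_coeff_eq_zero hr0
    (InvStep.sub_mem_span (Relation.ReflTransGen.single hstep) le_rfl).1 ?_
  rw [hr, coeff_sub, coeff_monomial_mul', if_pos tsub_le_self, tsub_tsub_cancel_of_le hdvd.1]
  change _ - _ / m.leadingCoeff f * m.leadingCoeff f = 0
  rw [div_mul_cancel₀ _ (m.leadingCoeff_ne_zero_iff.2 hf0), sub_self]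

/-- Covering lets every element of `I` be reduced to zero by cancelling leading terms, which yields
both generation and the prolongation condition. -/
theorem isInvBasis_of_forall_exists_invDvd (hFI : F ⊆ I)
    (hF0 : (0 : MvPolynomial (Fin n) K) ∉ F) (hred : InvAutoreduced m M F)
    (hcov : ∀ w ∈ leadExps m I, ∃ f ∈ F, InvDvd M (m.degree f) w) : IsInvBasis m M I F where
  zero_notMem := hF0
  span_eq := by
    refine le_antisymm (Ideal.span_le.2 hFI) fun h hh => ?_
    have := (InvStep.sub_mem_span (reflTransGen_invStep_zero hFI hF0 hcov hh) le_rfl).2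
    rw [sub_zero] at this
    refine (Submodule.span_le (p := (Ideal.span F).restrictScalars K)).2 ?_ this
    rintro _ ⟨g, hg, a, -, -, rfl⟩
    exact Ideal.mul_mem_left _ _ (Ideal.subset_span hg)
  autoreduced := hred
  prolongation f hf i _ :=
    ⟨reflTransGen_invStep_zero hFI hF0 hcov (I.mul_mem_right _ (hFI hf)), by simp [InvNormal]⟩

theorem IsInvBasis.congr {M' : Mon n → Fin n → Prop} (hF : IsInvBasis m M I F)
    (hM : ∀ f ∈ F, M (m.degree f) = M' (m.degree f)) : IsInvBasis m M' I F := by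
  have hdvd : ∀ f ∈ F, ∀ t, InvDvd M (m.degree f) t ↔ InvDvd M' (m.degree f) t := by
    intro f hf t
    rw [InvDvd, InvDvd, hM f hf]
  refine ⟨hF.zero_notMem, hF.span_eq, ?_, ?_⟩
  · intro f hf g hg hgf t ht
    rw [← hdvd g hg]
    exact hF.autoreduced f hf g hg hgf t ht
  · intro f hf i hi
    rw [← hM f hf] at hi
    refine ⟨Relation.ReflTransGen.mono ?_ _ _ (hF.prolongation f hf i hi).1, by simp [InvNormal]⟩
    rintro x y ⟨g, hg, t, ht, hgt, rfl⟩
    exact ⟨g, hg, t, ht, (hdvd g hg t).1 hgt, rfl⟩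

end InvolutiveBasis


/-! ### Strongly stable sets of monomials -/

section StableSets

variable {n : ℕ} {N : Set (Mon n)}

/-- In a strongly stable set of monomials every element has a minimal generator as Pommaret
divisor. -/
theorem exists_minGens_invDvd (hup : IsUpperSet N)
    (hst : ∀ i j : Fin n, i < j → ∀ v : Mon n, v + Finsupp.single j 1 ∈ N →
      v + Finsupp.single i 1 ∈ N) {w : Mon n} (hw : w ∈ N) :
    ∃ b ∈ minGens N, InvDvd PommaretMult b w := by
  -- Take a minimal Pommaret divisor `d` of `w` in `N`. Were it not a minimal generator, dividing it
  -- by its last variable `x_l` would give a smaller one.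
  obtain ⟨d, -, hd⟩ := exists_minimal_le_of_wellFoundedLT
    (fun d => d ∈ N ∧ InvDvd PommaretMult d w) w ⟨hw, invDvd_refl _ _⟩
  refine ⟨d, ⟨hd.prop.1, fun v hv hvd => ?_⟩, hd.prop.2⟩
  by_contra hdv
  obtain ⟨k, hk⟩ : ∃ k, v k < d k := by
    rw [Finsupp.le_def] at hdv
    push Not at hdv
    exact hdv
  have hne : d.support.Nonempty := ⟨k, Finsupp.mem_support_iff.2 (by omega)⟩
  set l := d.support.max' hne
  have hl : d l ≠ 0 := Finsupp.mem_support_iff.1 (d.support.max'_mem hne)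
  have hmax : ∀ j, d j ≠ 0 → j ≤ l := fun j hj =>
    d.support.le_max' j (Finsupp.mem_support_iff.2 hj)
  obtain ⟨e, he⟩ : ∃ e, d = e + Finsupp.single l 1 :=
    ⟨d - Finsupp.single l 1, (tsub_add_cancel_of_le
      (Finsupp.single_le_iff.2 (Nat.one_le_iff_ne_zero.2 hl))).symm⟩
  have hed : ∀ j, e j ≤ d j := fun j => by rw [he]; simp
  -- Here `v` properly divides `d`, with deficit at `k`. If `k = l`, then `v` divides `e`; if `k <
  -- l`, then `v` divides `d / x_k`, and exchanging `x_l` for `x_k` in it gives `e`.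
  have heN : e ∈ N := by
    rcases (hmax k (by omega)).lt_or_eq with hkl | hkl
    · have hek : e k = d k := by rw [he]; simp [Finsupp.single_eq_of_ne hkl.ne]
      obtain ⟨c, rfl⟩ : ∃ c, e = c + Finsupp.single k 1 :=
        ⟨e - Finsupp.single k 1, (tsub_add_cancel_of_le
          (Finsupp.single_le_iff.2 (by omega))).symm⟩
      refine hst k l hkl c (hup (fun j => ?_) hv)
      have hj := hvd j
      rw [he] at hj hk
      rcases eq_or_ne j k with rfl | hjk
      · simp [Finsupp.single_eq_of_ne hkl.ne] at hk ⊢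
        omega
      · simpa [Finsupp.single_eq_of_ne hjk] using hj
    · refine hup (fun j => ?_) hv
      have hj := hvd j
      rw [he] at hj hk
      rcases eq_or_ne j l with rfl | hjl
      · rw [hkl] at hk
        simp at hk
        omega
      · simpa [Finsupp.single_eq_of_ne hjl] using hj
  have hinv : InvDvd PommaretMult e w := by
    refine ⟨fun j => (hed j).trans (hd.prop.2.1 j), fun i hi j hj => ?_⟩
    have hjd : d j ≠ 0 := fun h => hj (Nat.le_zero.1 (h ▸ hed j))
    rcases eq_or_ne i l with rfl | hil
    · exact hmax j hjd
    · refine hd.prop.2.2 i ?_ j hjd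
      rw [he]
      simpa [Finsupp.single_eq_of_ne hil] using hi
  have := hd.le_of_le ⟨heN, hinv⟩ hed l
  rw [he] at this
  simp at this

/-- For the minimal generators of a strongly stable set the Pommaret and the Janet division
coincide. -/
theorem janetMult_minGens_eq (hup : IsUpperSet N)
    (hst : ∀ i j : Fin n, i < j → ∀ v : Mon n, v + Finsupp.single j 1 ∈ N →
      v + Finsupp.single i 1 ∈ N) {u : Mon n} (hu : u ∈ minGens N) :
    JanetMult (minGens N) u = PommaretMult u := by
  -- `b` has no variable beyond `x_i`, so a competitor `v` of larger degree in `x_i` would be a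
  -- proper multiple of `b`.
  have hPJ : ∀ b ∈ minGens N, ∀ i, PommaretMult b i → JanetMult (minGens N) b i := by
    intro b hb i hi v hv hbv
    by_contra! hlt
    have hle : b ≤ v := by
      intro l
      rcases lt_trichotomy l i with h | rfl | h
      · exact (hbv l h).ge
      · exact hlt.le
      · have : b l = 0 := by
          by_contra hbl
          exact absurd (hi l hbl) (not_le.2 h)
        omega
    have := hv.le_of_le hb.prop hle i
    omega
  funext i
  refine propext ⟨fun hi => ?_, hPJ u hu i⟩
  obtain ⟨b, hb, hbu⟩ := exists_minGens_invDvd hup hst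
    (hup (le_self_add : u ≤ u + Finsupp.single i 1) hu.prop)
  -- Both are Janet divisors of `u x_i`, and such a divisor is unique.
  obtain rfl : u = b := by
    refine InvDvd.janet_unique hu hb (t := u + Finsupp.single i 1) ?_
      ⟨hbu.1, fun j hj => hPJ b hb j (hbu.2 j hj)⟩
    rw [invDvd_add_iff]
    intro j hj
    rcases eq_or_ne j i with rfl | hji
    · exact hi
    · simp [Finsupp.single_eq_of_ne hji] at hj
  exact hbu.2 i (by simp)

end StableSets

/-! ### Comparison of the bases -/

section Bases

variable {K : Type*} [Field K] {n : ℕ} (m : MonomialOrder (Fin n))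

/-- A set of nonzero elements of `I`, one for every minimal generator of the initial ideal, whose
nonleading terms do not belong to the initial ideal. -/
structure IsTailReducedBasis (I : Ideal (MvPolynomial (Fin n) K))
    (G : Set (MvPolynomial (Fin n) K)) : Prop where
  subset : G ⊆ I
  zero_notMem : (0 : MvPolynomial (Fin n) K) ∉ G
  lmSet_eq : lmSet m G = minGens (leadExps m I)
  injOn : ∀ f ∈ G, ∀ g ∈ G, m.degree f = m.degree g → f = g
  tail : ∀ f ∈ G, ∀ t ∈ f.support, t ∈ leadExps m I → t = m.degree f

variable {m} {I : Ideal (MvPolynomial (Fin n) K)} {G : Set (MvPolynomial (Fin n) K)}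

theorem eq_degree_of_degree_le {f : MvPolynomial (Fin n) K} {t : Mon n} (ht : t ∈ f.support)
    (hle : m.degree f ≤ t) : t = m.degree f :=
  m.toSyn.injective (le_antisymm (m.le_degree ht) (m.toSyn_monotone hle))

theorem IsTailReducedBasis.eq_of_degree_le (hG : IsTailReducedBasis m I G)
    {f g : MvPolynomial (Fin n) K} (hf : f ∈ G) (hg : g ∈ G) {t : Mon n} (ht : t ∈ f.support)
    (hle : m.degree g ≤ t) : g = f := by
  have hgm : m.degree g ∈ minGens (leadExps m I) := hG.lmSet_eq ▸ ⟨g, hg, rfl⟩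
  have hfm : m.degree f ∈ minGens (leadExps m I) := hG.lmSet_eq ▸ ⟨f, hf, rfl⟩
  have htf := hG.tail f hf t ht (isUpperSet_leadExps m I hle hgm.prop)
  subst htf
  exact hG.injOn g hg f hf (le_antisymm hle (hfm.le_of_le hgm.prop hle))

theorem IsTailReducedBasis.finite (hG : IsTailReducedBasis m I G) : G.Finite := by
  refine Set.Finite.of_finite_image (f := m.degree) ?_ fun f hf g hg h => hG.injOn f hf g hg h
  exact (minGens_finite (leadExps m I)).subset (hG.lmSet_eq ▸ fun _ h => h)

theorem IsTailReducedBasis.isPommaretBasis (hG : IsTailReducedBasis m I G)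
    (hst : ∀ i j : Fin n, i < j → ∀ v : Mon n, v + Finsupp.single j 1 ∈ leadExps m I →
      v + Finsupp.single i 1 ∈ leadExps m I) : IsPommaretBasis m I G := by
  refine isInvBasis_of_forall_exists_invDvd hG.subset hG.zero_notMem ?_ fun w hw => ?_
  · intro f hf g hg hgf t ht hdvd
    exact hgf (hG.eq_of_degree_le hf hg ht hdvd.1)
  · obtain ⟨b, hb, hbw⟩ := exists_minGens_invDvd (isUpperSet_leadExps m I) hst hw
    obtain ⟨f, hf, rfl⟩ : b ∈ lmSet m G := hG.lmSet_eq ▸ hb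
    exact ⟨f, hf, hbw⟩

theorem minGens_subset_lmSet {M : Mon n → Fin n → Prop} (hG : IsInvBasis m M I G)
    (hcov : ∀ w ∈ leadExps m I, ∃ f ∈ G, InvDvd M (m.degree f) w) :
    minGens (leadExps m I) ⊆ lmSet m G := by
  intro b hb
  obtain ⟨f, hf, hfb⟩ := hcov b hb.prop
  exact ⟨f, hf, le_antisymm hfb.1 (hb.le_of_le (hG.degree_mem hf) hfb.1)⟩

/-- Since every leading exponent has a Pommaret divisor in the basis, Pommaret autoreduction
excludes superfluous leading monomials and leaves no tail term in the initial ideal. -/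
theorem IsPommaretBasis.isTailReducedBasis (hG : IsPommaretBasis m I G)
    (hst : ∀ i j : Fin n, i < j → ∀ v : Mon n, v + Finsupp.single j 1 ∈ leadExps m I →
      v + Finsupp.single i 1 ∈ leadExps m I) : IsTailReducedBasis m I G where
  subset := fun f hf => hG.span_eq ▸ Ideal.subset_span hf
  zero_notMem := hG.zero_notMem
  lmSet_eq := by
    have hsub := minGens_subset_lmSet hG fun w hw => hG.exists_invDvd hw
    refine Set.Subset.antisymm ?_ hsub
    rintro _ ⟨f, hf, rfl⟩
    obtain ⟨b, hb, hbf⟩ :=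
      exists_minGens_invDvd (isUpperSet_leadExps m I) hst (hG.degree_mem hf)
    obtain ⟨g, hg, rfl⟩ := hsub hb
    rwa [← hG.eq_of_invDvd hf hg hbf]
  injOn f hf g hg h := (hG.eq_of_invDvd hg hf (h ▸ invDvd_refl _ _))
  tail f hf t ht htI := by
    obtain ⟨g, hg, hgt⟩ := hG.exists_invDvd htI
    obtain rfl : g = f := by
      by_contra hne
      exact hG.autoreduced f hf g hg hne t ht hgt
    exact eq_degree_of_degree_le ht hgt.1

theorem IsReducedGroebnerBasis.isTailReducedBasis (hG : IsReducedGroebnerBasis m I G) :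
    IsTailReducedBasis m I G := by
  have h0 : (0 : MvPolynomial (Fin n) K) ∉ G := fun h => by simpa using hG.monic 0 h
  have hne : ∀ f ∈ G, f ≠ 0 := fun f hf h => h0 (h ▸ hf)
  have hmem : ∀ f ∈ G, m.degree f ∈ leadExps m I := fun f hf => ⟨f, hG.subset hf, hne f hf, rfl⟩
  have hcov : ∀ w ∈ leadExps m I, ∃ g ∈ G, m.degree g ≤ w := by
    intro w hw
    have himg : {p | ∃ g ∈ G, p = monomial (m.degree g) (1 : K)} =
        (fun u => monomial u (1 : K)) '' lmSet m G := by
      ext p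
      constructor
      · rintro ⟨g, hg, rfl⟩
        exact ⟨_, ⟨g, hg, rfl⟩, rfl⟩
      · rintro ⟨_, ⟨g, hg, rfl⟩, rfl⟩
        exact ⟨g, hg, rfl⟩
    rw [mem_leadExps_iff, ← hG.initial, himg, monomial_mem_span_iff] at hw
    obtain ⟨_, ⟨g, hg, rfl⟩, hle⟩ := hw
    exact ⟨g, hg, hle⟩
  have hred : ∀ f ∈ G, ∀ g ∈ G, ∀ t ∈ f.support, m.degree g ≤ t → g = f := by
    intro f hf g hg t ht hle
    by_contra hgf
    exact hG.reduced f hf g hg hgf t ht hle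
  refine ⟨hG.subset, h0, ?_, ?_, ?_⟩
  · ext b
    constructor
    · rintro ⟨f, hf, rfl⟩
      refine ⟨hmem f hf, fun v hv hvf => ?_⟩
      obtain ⟨g, hg, hgv⟩ := hcov v hv
      obtain rfl := hred f hf g hg _ (m.degree_mem_support (hne f hf)) (hgv.trans hvf)
      exact hgv
    · intro hb
      obtain ⟨g, hg, hgb⟩ := hcov b hb.prop
      exact ⟨g, hg, le_antisymm hgb (hb.le_of_le (hmem g hg) hgb)⟩
  · intro f hf g hg h
    exact hred g hg f hf _ (m.degree_mem_support (hne g hg)) h.le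
  · intro f hf t ht htI
    obtain ⟨g, hg, hgt⟩ := hcov t htI
    obtain rfl := hred f hf g hg t ht hgt
    exact eq_degree_of_degree_le ht hgt

theorem IsTailReducedBasis.isReducedGroebnerBasis (hG : IsTailReducedBasis m I G)
    (hmon : IsMonicSet m G) : IsReducedGroebnerBasis m I G where
  finite := hG.finite
  subset := hG.subset
  initial := by
    refine le_antisymm (Ideal.span_mono ?_) ?_
    · rintro _ ⟨g, hg, rfl⟩
      exact ⟨g, hG.subset hg, fun h => hG.zero_notMem (h ▸ hg), rfl⟩
    · refine Ideal.span_le.2 ?_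
      rintro _ ⟨f, hf, hf0, rfl⟩
      obtain ⟨b, hb, hbf⟩ := exists_minGens_le (N := leadExps m I) ⟨f, hf, hf0, rfl⟩
      obtain ⟨g, hg, rfl⟩ : b ∈ lmSet m G := hG.lmSet_eq ▸ hb
      refine Ideal.mem_of_dvd _ ?_ (Ideal.subset_span ⟨g, hg, rfl⟩)
      exact monomial_dvd_monomial.2 ⟨Or.inr hbf, one_dvd _⟩
  monic := hmon
  reduced f hf g hg hgf t ht hle := hgf (hG.eq_of_degree_le hf hg ht hle)

/-- Two monic elements with the same leading monomial differ by an element of `I` whose leading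
exponent could only be that common one, where the coefficients cancel. -/
theorem IsTailReducedBasis.eq_of_isMonicSet {G' : Set (MvPolynomial (Fin n) K)}
    (hG : IsTailReducedBasis m I G) (hG' : IsTailReducedBasis m I G') (hmon : IsMonicSet m G)
    (hmon' : IsMonicSet m G') : G ⊆ G' := by
  classical
  intro f hf
  obtain ⟨g, hg, hgf⟩ : m.degree f ∈ lmSet m G' := by
    rw [hG'.lmSet_eq, ← hG.lmSet_eq]
    exact ⟨f, hf, rfl⟩
  suffices f = g from this ▸ hg
  by_contra hne
  have h0 : f - g ≠ 0 := sub_ne_zero.2 hne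
  have hmem : m.degree (f - g) ∈ leadExps m I :=
    ⟨_, I.sub_mem (hG.subset hf) (hG'.subset hg), h0, rfl⟩
  have hdeg : m.degree (f - g) = m.degree f := by
    rcases Finset.mem_union.1 (support_sub (Fin n) f g (m.degree_mem_support h0)) with h | h
    · exact hG.tail f hf _ h hmem
    · rw [hG'.tail g hg _ h hmem, hgf]
  refine m.coeff_degree_ne_zero_iff.2 h0 ?_
  have h1 := hmon f hf
  have h2 := hmon' g hg
  rw [MonomialOrder.leadingCoeff] at h1 h2
  rw [hdeg, coeff_sub, h1, ← hgf, h2, sub_self]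

variable (m I) in
theorem exists_isTailReducedBasis :
    ∃ G : Set (MvPolynomial (Fin n) K), IsTailReducedBasis m I G ∧ IsMonicSet m G := by
  classical
  have key : ∀ b ∈ leadExps m I, ∃ f ∈ I, f.coeff b = 1 ∧ m.degree f = b ∧
      ∀ t ∈ f.support, t ∈ leadExps m I → t = b := by
    intro b hb
    -- Dividing by all nonzero elements of `I` leaves a remainder with no term in the initial ideal;
    -- the monomial minus this remainder is the desired element.
    obtain ⟨g, r, hgr, -, hr⟩ := m.div_set (B := {f | f ∈ I ∧ f ≠ 0})
      (fun f hf => m.isUnit_leadingCoeff.2 hf.2) (monomial b (1 : K))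
    have hrN : ∀ t ∈ r.support, t ∉ leadExps m I := by
      rintro t ht ⟨f, hf, hf0, rfl⟩
      exact hr _ ht f ⟨hf, hf0⟩ le_rfl
    have hrb : r.coeff b = 0 := by
      by_contra h
      exact hrN b (mem_support_iff.2 h) hb
    set f := monomial b (1 : K) - r with hf
    have hfI : f ∈ I := by
      rw [hf, hgr, add_sub_cancel_right, Finsupp.linearCombination_apply]
      exact I.sum_mem fun p _ => I.mul_mem_left _ p.2.1
    have hfb : f.coeff b = 1 := by rw [hf, coeff_sub, hrb, coeff_monomial, if_pos rfl, sub_zero]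
    have hf0 : f ≠ 0 := fun h => by simp [h] at hfb
    have htail : ∀ t ∈ f.support, t ∈ leadExps m I → t = b := by
      intro t ht htI
      rcases Finset.mem_union.1 (support_sub (Fin n) _ _ ht) with h | h
      · exact Finset.mem_singleton.1 (support_monomial_subset h)
      · exact absurd htI (hrN t h)
    exact ⟨f, hfI, hfb, htail _ (m.degree_mem_support hf0) ⟨f, hfI, hf0, rfl⟩, htail⟩
  choose! F hFI hF1 hFd hFt using key
  have hsub := minGens_subset (leadExps m I)
  refine ⟨F '' minGens (leadExps m I), ⟨?_, ?_, ?_, ?_, ?_⟩, ?_⟩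
  · rintro _ ⟨b, hb, rfl⟩
    exact hFI b (hsub hb)
  · rintro ⟨b, hb, h⟩
    have := hF1 b (hsub hb)
    simp [h] at this
  · ext b
    constructor
    · rintro ⟨_, ⟨c, hc, rfl⟩, rfl⟩
      rwa [hFd c (hsub hc)]
    · intro hb
      exact ⟨_, ⟨b, hb, rfl⟩, hFd b (hsub hb)⟩
  · rintro _ ⟨b, hb, rfl⟩ _ ⟨c, hc, rfl⟩ h
    rw [hFd b (hsub hb), hFd c (hsub hc)] at h
    rw [h]
  · rintro _ ⟨b, hb, rfl⟩ t ht htI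
    rw [hFd b (hsub hb)]
    exact hFt b (hsub hb) t ht htI
  · rintro _ ⟨b, hb, rfl⟩
    rw [MonomialOrder.leadingCoeff, hFd b (hsub hb), hF1 b (hsub hb)]

theorem isMinimalJanetBasis_iff_isPommaretBasis
    (hst : ∀ i j : Fin n, i < j → ∀ v : Mon n, v + Finsupp.single j 1 ∈ leadExps m I →
      v + Finsupp.single i 1 ∈ leadExps m I) :
    IsMinimalJanetBasis m I G ↔ IsPommaretBasis m I G := by
  have hup := isUpperSet_leadExps m I
  have hsub : ∀ F, IsJanetBasis m I F → minGens (leadExps m I) ⊆ lmSet m F :=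
    fun F hF => minGens_subset_lmSet hF.2 fun w hw => hF.exists_invDvd hw
  have hmult : ∀ F : Set (MvPolynomial (Fin n) K), lmSet m F = minGens (leadExps m I) →
      ∀ f ∈ F, JanetMult (lmSet m F) (m.degree f) = PommaretMult (m.degree f) := by
    intro F hF f hf
    rw [hF]
    exact janetMult_minGens_eq hup hst (hF ▸ ⟨f, hf, rfl⟩)
  have hPJ : ∀ F, IsPommaretBasis m I F → IsMinimalJanetBasis m I F := by
    intro F hF
    have hFt := hF.isTailReducedBasis hst
    refine ⟨⟨hFt.finite, IsInvBasis.congr hF fun f hf => (hmult F hFt.lmSet_eq f hf).symm⟩, ?_⟩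
    intro F' hF'
    rw [hFt.lmSet_eq]
    exact hsub F' hF'
  refine ⟨fun hG => ?_, hPJ G⟩
  -- `G₀` is a Janet basis whose leading monomials are just the minimal generators, so minimality of
  -- `G` leaves it no others.
  obtain ⟨G₀, hG₀, -⟩ := exists_isTailReducedBasis m I
  have hlm : lmSet m G = minGens (leadExps m I) :=
    Set.Subset.antisymm
      (hG₀.lmSet_eq ▸ hG.2 G₀ (hPJ G₀ (hG₀.isPommaretBasis hst)).1) (hsub G hG.1)
  exact hG.1.2.congr (hmult G hlm)

end Bases

theorem corollary4 {K : Type*} [Field K] [CharZero K] {n : ℕ}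
    (m : MonomialOrder (Fin n))
    (hm : ∀ i j : Fin n, i < j →
      m.toSyn (Finsupp.single j 1) < m.toSyn (Finsupp.single i 1))
    (I : Ideal (MvPolynomial (Fin n) K)) (hI : IsInGenericPosition m I) :
    (∃! G : Set (MvPolynomial (Fin n) K), IsMinimalJanetBasis m I G ∧ IsMonicSet m G) ∧
    (∀ G : Set (MvPolynomial (Fin n) K),
      IsMinimalJanetBasis m I G ↔ IsPommaretBasis m I G) ∧
    (IsHomogeneousIdeal I →
      ∀ G : Set (MvPolynomial (Fin n) K),
        (IsReducedGroebnerBasis m I G ↔ IsMinimalJanetBasis m I G ∧ IsMonicSet m G) ∧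
        (IsReducedGroebnerBasis m I G ↔ IsPommaretBasis m I G ∧ IsMonicSet m G)) := by
  have hst : ∀ i j : Fin n, i < j → ∀ v : Mon n, v + Finsupp.single j 1 ∈ leadExps m I →
      v + Finsupp.single i 1 ∈ leadExps m I := fun i j hij v hv => hI.exchange m (hm i j hij) hv
  have hJP : ∀ G : Set (MvPolynomial (Fin n) K),
      IsMinimalJanetBasis m I G ↔ IsPommaretBasis m I G :=
    fun G => isMinimalJanetBasis_iff_isPommaretBasis hst
  have hGP : ∀ G : Set (MvPolynomial (Fin n) K),
      IsReducedGroebnerBasis m I G ↔ IsPommaretBasis m I G ∧ IsMonicSet m G := fun G =>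
    ⟨fun h => ⟨h.isTailReducedBasis.isPommaretBasis hst, h.monic⟩,
      fun h => (h.1.isTailReducedBasis hst).isReducedGroebnerBasis h.2⟩
  refine ⟨?_, hJP, fun _ G => ⟨by rw [hGP, hJP], hGP G⟩⟩
  simp only [hJP]
  obtain ⟨G, hG, hmon⟩ := exists_isTailReducedBasis m I
  refine ⟨G, ⟨hG.isPommaretBasis hst, hmon⟩, fun G' hG' => ?_⟩
  have hG't := hG'.1.isTailReducedBasis hst
  exact Set.Subset.antisymm (hG't.eq_of_isMonicSet hG hG'.2 hmon)
    (hG.eq_of_isMonicSet hG't hmon hG'.2)
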